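/- For a topological space $Z$ and $k\ge 1$ let $\mathcal B_k(Z)$ be the set of probability measures on $Z$ supported on at most $k$ points, with the quotient topology from the surjection $\Delta^{k-1}\times Z^k\to\mathcal B_k(Z)$, $(t,z)\mapsto\sum_i t_i\delta_{z_i}$. For a continuous map $f:X\to Y$ and a base point $y_0\in Y$, the distributional category $d\mathrm{cat}(f)\in\mathbb N\cup\{\infty\}$ is the least $k\ge 0$ for which there is a continuous map $s:X\to\mathcal B_{k+1}(Y^{[0,1]})$ (paths with the compact-open topology) such that, for every $x\in X$, $s(x)$ is supported on paths from $f(x)$ to $y_0$; it is $\infty$ if there is no such $k$. Let $G$ be a finite group with $|G|=n+1$ acting freely and continuously on a non-empty finite CW complex $X$. Let $p_G:EG\to BG$ be a universal $G$-covering, i.e. $EG$ is a contractible space with a free, properly discontinuous $G$-action and $p_G$ is the quotient map onto the orbit space $BG$, let $b_0\in BG$ be any base point, and let $u:X/G\to BG$ be a classifying map of the covering $X\to X/G$, i.e. a continuous map covered by a $G$-equivariant continuous map $X\to EG$. For $f:X\to\mathbb R$ put $A_f=\{x\in X : |f(Gx)|=1\}$. Then the following are equivalent: 1. $d\mathrm{cat}(u)\ge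 n$ (with respect to the base point $b_0$). 2. $A_f\ne\emptyset$ for every continuous function $f:X\to\mathbb R$. -/

import Mathlib

noncomputable section

/-- `FinProb n Z` is the space of probability measures on `Z` supported on at most `n` points,
a measure `∑ t_z δ_z` being recorded by its finitely supported weight function `z ↦ t_z`. -/
def FinProb (n : ℕ) (Z : Type*) : Type _ :=
  {w : Z →₀ ℝ // (∀ z, 0 ≤ w z) ∧ (w.sum fun _ t => t) = 1 ∧ w.support.card ≤ n}

/-- The underlying weight of the measure `∑ i, t i • δ_(x i)`. -/
def formalSum {n : ℕ} {Z : Type*} (t : Fin n → ℝ) (x : Fin n → Z) : Z →₀ ℝ :=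
  ∑ i, Finsupp.single (x i) (t i)

theorem formalSum_mem {n : ℕ} {Z : Type*} (t : stdSimplex ℝ (Fin n)) (x : Fin n → Z) :
    (∀ z, 0 ≤ formalSum t.1 x z) ∧ ((formalSum t.1 x).sum fun _ s => s) = 1 ∧
      (formalSum t.1 x).support.card ≤ n := by
  classical
  refine ⟨fun z => ?_, ?_, ?_⟩
  · rw [formalSum, Finsupp.finsetSum_apply]
    refine Finset.sum_nonneg fun i _ => ?_
    rw [Finsupp.single_apply]
    split_ifs
    · exact t.2.1 i
    · exact le_rfl
  · rw [formalSum, ← Finsupp.sum_finsetSum_index (fun _ => rfl) (fun _ _ _ => rfl)]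
    simp only [Finsupp.sum_single_index]
    exact t.2.2
  · have h : (formalSum t.1 x).support ⊆ Finset.univ.image x := by
      refine Finsupp.support_finsetSum.trans ?_
      intro z hz
      simp only [Finset.mem_biUnion] at hz
      obtain ⟨i, -, hi⟩ := hz
      have hzi := Finset.mem_singleton.1 (Finsupp.support_single_subset hi)
      exact Finset.mem_image.2 ⟨i, Finset.mem_univ i, hzi.symm⟩
    exact (Finset.card_le_card h).trans
      (Finset.card_image_le.trans (by simp))

/-- The map `Δⁿ⁻¹ × Zⁿ → FinProb n Z`, `(t, x) ↦ ∑ i, t i • δ_(x i)`. -/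
def FinProb.mk' (n : ℕ) (Z : Type*) (q : stdSimplex ℝ (Fin n) × (Fin n → Z)) : FinProb n Z :=
  ⟨formalSum q.1.1 q.2, formalSum_mem q.1 q.2⟩

/-- The quotient topology: `FinProb n Z` is a quotient of the space of formal sums
`t₁ x₁ + ⋯ + tₙ xₙ` (the symmetric join), itself a quotient of `Δⁿ⁻¹ × Zⁿ`. -/
instance FinProb.instTopologicalSpace (n : ℕ) (Z : Type*) [TopologicalSpace Z] :
    TopologicalSpace (FinProb n Z) :=
  TopologicalSpace.coinduced (FinProb.mk' n Z) inferInstance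

/-- `dcat f ≤ n` for a map `f : X → Y` and a base point `y₀` of `Y`: there is a continuous map `s`
from `X` to the probability measures on at most `n + 1` paths in `Y` (with the compact-open
topology) such that `s x` is supported on paths from `f x` to `y₀`. -/
def DcatLE {X Y : Type*} [TopologicalSpace X] [TopologicalSpace Y] (f : C(X, Y)) (y₀ : Y)
    (n : ℕ) : Prop :=
  ∃ s : C(X, FinProb (n + 1) C(unitInterval, Y)),
    ∀ x, ∀ γ ∈ (s x).1.support, γ 0 = f x ∧ γ 1 = y₀

/-- The distributional category of a map; it is `⊤` if no `n` as in `DcatLE` exists. -/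
def dcat {X Y : Type*} [TopologicalSpace X] [TopologicalSpace Y] (f : C(X, Y)) (y₀ : Y) : ℕ∞ :=
  sInf {m : ℕ∞ | ∃ n : ℕ, m = n ∧ DcatLE f y₀ n}

/-- `p : EG → BG` is a universal `G`-covering: `EG` is contractible and `p` is the (covering)
quotient map of a free, properly discontinuous action of the discrete group `G` on `EG`. -/
structure IsUniversalGCovering (G : Type*) [Group G] {EG BG : Type*} [TopologicalSpace EG]
    [TopologicalSpace BG] [MulAction G EG] (p : C(EG, BG)) : Prop where
  contractible : ContractibleSpace EG
  isQuotientCoveringMap : IsQuotientCoveringMap p G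

/-- `u : X/G → BG` classifies `X → X/G`: it is covered by a `G`-equivariant map `X → EG`. -/
def IsClassifyingMap (G : Type*) [Group G] {X EG BG : Type*} [TopologicalSpace X]
    [MulAction G X] [TopologicalSpace EG] [TopologicalSpace BG] [MulAction G EG]
    (p : C(EG, BG)) (u : C(MulAction.orbitRel.Quotient G X, BG)) : Prop :=
  ∃ v : C(X, EG), (∀ (g : G) (x : X), v (g • x) = g • v x) ∧
    ∀ x : X, p (v x) = u (Quotient.mk _ x)

/-- The coincidence set `{x | |f (G x)| = 1}` of a function `f`. -/
def coincidenceSet (G : Type*) [Group G] {X : Type*} [MulAction G X] (f : X → ℝ) : Set X :=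
  {x | (f '' MulAction.orbit G x).encard = 1}

end

open Topology

/-! Both implications are proved by contraposition, using G as the fibre of p over `b₀ = p e₀` and v
as the equivariant map covering u. If s is a section by measures on fewer than |G| paths, let f(x)
be the mass that s([x]) gives to the paths whose lift from v(x) ends at e₀. Each path in the support
serves exactly one point of the orbit Gx, so f vanishes somewhere on Gx and is positive elsewhere.
Continuity of f (`continuous_mass_liftableFromTo`) is the delicate point: f is locally the mass of
an open set of paths, and so is 1 - f, while such masses are only lower semicontinuous. Conversely,
if f is constant on no orbit, subtract its orbit minimum and normalise to weights w with sum 1 on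
each orbit and a zero on each orbit. Contractibility gives paths from v(gx) to e₀; weighting their
projections by w(gx) yields a G-invariant measure on at most |G| - 1 paths. -/

/-! ### Lifting paths through a covering -/

/-- Post-composition with a covering map is an open map on path spaces. -/
theorem IsCoveringMap.isOpenMap_comp_path {E B : Type*} [TopologicalSpace E] [TopologicalSpace B]
    {p : C(E, B)} (cov : IsCoveringMap p) :
    IsOpenMap fun Γ : C(unitInterval, E) => p.comp Γ := by
  intro S hS
  rw [isOpen_iff_mem_nhds]
  rintro _ ⟨Γ₀, hΓ₀, rfl⟩
  obtain ⟨φ, hφ, hpφ⟩ := cov.isLocalHomeomorph (Γ₀ 0)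
  set A : Set C(unitInterval, B) := {γ | γ 0 ∈ φ.target} with hA
  have hAo : IsOpen A := φ.open_target.preimage (continuous_eval_const 0)
  -- Homotopy lifting with parameter space A, started by the local inverse of p near Γ₀(0), gives a
  -- continuous section L of post-composition through Γ₀.
  let H : C(unitInterval × A, B) := ⟨fun q => q.2.1 q.1, by fun_prop⟩
  let σ : C(A, E) := ⟨fun γ => φ.symm (γ.1 0), by
    refine φ.continuousOn_symm.comp_continuous ?_ fun γ => γ.2
    exact (continuous_eval_const 0).comp continuous_subtype_val⟩
  have hσ : ∀ γ, H (0, γ) = p (σ γ) := fun γ => by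
    rw [hpφ]
    exact (φ.right_inv γ.2).symm
  let K : C(A × unitInterval, E) := (cov.liftHomotopy H σ hσ).comp
    ⟨Prod.swap, continuous_swap⟩
  let L : C(A, C(unitInterval, E)) := K.curry
  have hL : ∀ γ, p.comp (L γ) = γ.1 := fun γ => by
    ext t
    exact congr_fun (cov.liftHomotopy_lifts H σ hσ) (t, γ)
  have hmem : p.comp Γ₀ ∈ A := by
    change p (Γ₀ 0) ∈ φ.target
    rw [hpφ]
    exact φ.map_source hφ
  have hL₀ : L ⟨p.comp Γ₀, hmem⟩ = Γ₀ := by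
    apply DFunLike.coe_injective
    refine cov.eq_of_comp_eq (L _).continuous Γ₀.continuous ?_ 0 ?_
    · funext t
      exact congrArg (fun γ : C(unitInterval, B) => γ t) (hL ⟨p.comp Γ₀, hmem⟩)
    · refine (cov.liftHomotopy_zero H σ hσ _).trans ?_
      change φ.symm (p (Γ₀ 0)) = Γ₀ 0
      rw [hpφ]
      exact φ.left_inv hφ
  have ho : IsOpen (Subtype.val '' (L ⁻¹' S)) := hAo.isOpenMap_subtype_val _ (hS.preimage L.2)
  refine Filter.mem_of_superset (ho.mem_nhds ⟨⟨_, hmem⟩, ?_, rfl⟩) ?_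
  · rw [Set.mem_preimage, hL₀]
    exact hΓ₀
  · rintro _ ⟨γ, hγ, rfl⟩
    exact ⟨L γ, hγ, hL γ⟩

/-- The paths in the base that lift to a path from `V` to `W`. -/
def liftableFromTo {E B : Type*} [TopologicalSpace E] [TopologicalSpace B] (p : C(E, B))
    (V W : Set E) : Set C(unitInterval, B) :=
  {γ | ∃ Γ : C(unitInterval, E), p.comp Γ = γ ∧ Γ 0 ∈ V ∧ Γ 1 ∈ W}

theorem IsCoveringMap.isOpen_liftableFromTo {E B : Type*} [TopologicalSpace E]
    [TopologicalSpace B] {p : C(E, B)} (cov : IsCoveringMap p) {V W : Set E} (hV : IsOpen V)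
    (hW : IsOpen W) : IsOpen (liftableFromTo p V W) := by
  have h : IsOpen {Γ : C(unitInterval, E) | Γ 0 ∈ V ∧ Γ 1 ∈ W} :=
    (hV.preimage (continuous_eval_const 0)).inter
      (hW.preimage (continuous_eval_const 1))
  convert! cov.isOpenMap_comp_path _ h using 1
  ext γ
  exact ⟨fun ⟨Γ, h₁, h₂⟩ => ⟨Γ, h₂, h₁⟩, fun ⟨Γ, h₁, h₂⟩ => ⟨Γ, h₂, h₁⟩⟩

/-! ### Masses of finitely supported measures -/

namespace FinProb

variable {n : ℕ} {Z : Type*}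

/-- The measure of a set. -/
noncomputable def mass (μ : FinProb n Z) (A : Set Z) : ℝ :=
  μ.1.sum fun z t => A.indicator (fun _ => t) z

theorem mass_mk' (q : stdSimplex ℝ (Fin n) × (Fin n → Z)) (A : Set Z) :
    (mk' n Z q).mass A = ∑ i, A.indicator (fun _ => q.1.1 i) (q.2 i) := by
  classical
  change (formalSum q.1.1 q.2).sum _ = _
  rw [formalSum, ← Finsupp.sum_finsetSum_index]
  · refine Finset.sum_congr rfl fun i _ => ?_
    rw [Finsupp.sum_single_index]
    simp
  · simp
  · intro z s t
    by_cases hz : z ∈ A <;> simp [hz]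

theorem mass_nonneg (μ : FinProb n Z) (A : Set Z) : 0 ≤ μ.mass A :=
  Finset.sum_nonneg fun z _ => Set.indicator_nonneg (fun _ _ => μ.2.1 z) _

theorem mass_congr (μ : FinProb n Z) {A B : Set Z} (h : ∀ z ∈ μ.1.support, z ∈ A ↔ z ∈ B) :
    μ.mass A = μ.mass B := by
  refine Finset.sum_congr rfl fun z hz => ?_
  change A.indicator _ z = B.indicator _ z
  by_cases hA : z ∈ A
  · rw [Set.indicator_of_mem hA, Set.indicator_of_mem ((h z hz).1 hA)]
  · rw [Set.indicator_of_notMem hA, Set.indicator_of_notMem fun hB => hA ((h z hz).2 hB)]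

theorem mass_add_mass_compl (μ : FinProb n Z) (A : Set Z) : μ.mass A + μ.mass Aᶜ = 1 := by
  rw [← μ.2.2.1, mass, mass, ← Finsupp.sum_add]
  refine Finset.sum_congr rfl fun z _ => ?_
  by_cases hA : z ∈ A <;> simp [hA]

theorem mass_pos (μ : FinProb n Z) {A : Set Z} {z : Z} (hz : z ∈ μ.1.support) (hA : z ∈ A) :
    0 < μ.mass A := by
  refine Finset.sum_pos' (fun w _ => Set.indicator_nonneg (fun _ _ => μ.2.1 w) _) ⟨z, hz, ?_⟩
  change 0 < A.indicator _ z
  rw [Set.indicator_of_mem hA]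
  exact (μ.2.1 z).lt_of_ne' (Finsupp.mem_support_iff.1 hz)

theorem mass_eq_zero (μ : FinProb n Z) {A : Set Z} (h : ∀ z ∈ μ.1.support, z ∉ A) :
    μ.mass A = 0 :=
  Finset.sum_eq_zero fun z hz => Set.indicator_of_notMem (h z hz) _

theorem support_nonempty (μ : FinProb n Z) : μ.1.support.Nonempty := by
  rw [Finset.nonempty_iff_ne_empty]
  intro h
  have := μ.2.2.1
  rw [Finsupp.sum, h, Finset.sum_empty] at this
  exact zero_ne_one this

/-- The measure of an open set depends lower semicontinuously on the measure. -/
theorem lowerSemicontinuous_mass [TopologicalSpace Z] {A : Set Z} (hA : IsOpen A) :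
    LowerSemicontinuous fun μ : FinProb n Z => μ.mass A := by
  rw [lowerSemicontinuous_iff_isOpen_preimage]
  intro c
  rw [isOpen_coinduced]
  have h : LowerSemicontinuous fun q : stdSimplex ℝ (Fin n) × (Fin n → Z) =>
      ∑ i, A.indicator (fun _ => q.1.1 i) (q.2 i) := by
    refine lowerSemicontinuous_sum fun i _ => ?_
    rw [lowerSemicontinuous_iff_isOpen_preimage]
    intro c
    -- The indicator is 0 off A, so it exceeds a negative c everywhere, and c ≥ 0 only where the
    -- point lies in A.
    rcases lt_or_ge c 0 with hc | hc
    · convert! isOpen_univ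
      refine Set.eq_univ_of_forall fun q => hc.trans_le ?_
      exact Set.indicator_nonneg (fun _ _ => q.1.2.1 i) _
    · have h₁ : IsOpen {q : stdSimplex ℝ (Fin n) × (Fin n → Z) | c < q.1.1 i ∧ q.2 i ∈ A} := by
        refine (isOpen_Ioi.preimage (t := Set.Ioi c) ?_).inter (hA.preimage ?_)
        · exact (continuous_apply i).comp (continuous_subtype_val.comp continuous_fst)
        · exact (continuous_apply i).comp continuous_snd
      convert! h₁ using 1
      ext q
      by_cases hq : q.2 i ∈ A <;> simp [hq, hc]
  convert! h.isOpen_preimage c using 1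
  ext q
  simp only [Set.mem_preimage, Set.mem_Ioi, mass_mk']

end FinProb

/-! ### From a section to a function -/

/-- A fibre point of a covering is separated from the rest of its fibre by open sets. -/
theorem IsCoveringMap.exists_isOpen_fiber {E B : Type*} [TopologicalSpace E]
    [TopologicalSpace B] {p : E → B} (cov : IsCoveringMap p) (e₀ : E) :
    ∃ V W : Set E, IsOpen V ∧ IsOpen W ∧
      ∀ e, p e = p e₀ → (e ∈ V ↔ e = e₀) ∧ (e ∈ W ↔ e ≠ e₀) := by
  choose U hUo hU hinj using cov.isLocalHomeomorph.isLocallyInjective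
  refine ⟨U e₀, ⋃ e ∈ {e | p e = p e₀ ∧ e ≠ e₀}, U e, hUo e₀,
    isOpen_biUnion fun e _ => hUo e, fun e he => ⟨⟨fun h => hinj e₀ h (hU e₀) he, ?_⟩, ?_, ?_⟩⟩
  · rintro rfl
    exact hU e
  · rintro h rfl
    obtain ⟨e', ⟨he', hne⟩, hmem⟩ := Set.mem_iUnion₂.1 h
    exact hne (hinj e' (hU e') hmem he')
  · exact fun h => Set.mem_biUnion (⟨he, h⟩ : p e = p e₀ ∧ e ≠ e₀) (hU e)

/-- V meets the fibre of e only in e, so every lift starting in V is Γ by uniqueness of lifts. -/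
theorem IsCoveringMap.liftableFromTo_singleton_iff {E B : Type*} [TopologicalSpace E]
    [TopologicalSpace B] {p : C(E, B)} (cov : IsCoveringMap p) {V W : Set E} {e : E}
    (hV : ∀ e' ∈ V, p e' = p e → e' = e) (he : e ∈ V) (Γ : C(unitInterval, E)) (hΓ : Γ 0 = e) :
    p.comp Γ ∈ liftableFromTo p V W ↔ Γ 1 ∈ W := by
  refine ⟨?_, fun h => ⟨Γ, rfl, hΓ ▸ he, h⟩⟩
  rintro ⟨Γ', hc, h0, h1⟩
  have hcomp : p ∘ Γ' = p ∘ Γ := congrArg DFunLike.coe hc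
  have h0' : Γ' 0 = Γ 0 := by
    rw [hΓ]
    exact hV _ h0 ((congr_fun hcomp 0).trans (congrArg p hΓ))
  have := cov.eq_of_comp_eq Γ'.continuous Γ.continuous hcomp 0 h0'
  rwa [← this]

/-- The weight of the paths whose lift starting at `v x` ends at `e₀` varies continuously. -/
theorem continuous_mass_liftableFromTo {X E B : Type*} [TopologicalSpace X] [TopologicalSpace E]
    [TopologicalSpace B] {p : C(E, B)} (cov : IsCoveringMap p) {m : ℕ} (e₀ : E) (v : C(X, E))
    (s : C(X, FinProb m C(unitInterval, B)))
    (hs : ∀ x, ∀ γ ∈ (s x).1.support, γ 0 = p (v x) ∧ γ 1 = p e₀) :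
    Continuous fun x => (s x).mass (liftableFromTo p {v x} {e₀}) := by
  obtain ⟨V, W, hV, hW, hVW⟩ := cov.exists_isOpen_fiber e₀
  rw [continuous_iff_continuousAt]
  intro x₀
  obtain ⟨U, hU, hxU, hinj⟩ := cov.isLocalHomeomorph.isLocallyInjective (v x₀)
  have hN : ∀ᶠ x in 𝓝 x₀, v x ∈ U := v.continuous.continuousAt (hU.mem_nhds hxU)
  -- Near x₀ the moving start v(x) is replaced by the fixed open set U, and the endpoint conditions
  -- e₀ and "not e₀" by V and W. Lower semicontinuity of the two complementary masses then gives
  -- both one-sided bounds.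
  have key : ∀ x, v x ∈ U →
      (s x).mass (liftableFromTo p U V) = (s x).mass (liftableFromTo p {v x} {e₀}) ∧
      (s x).mass (liftableFromTo p U W) = 1 - (s x).mass (liftableFromTo p {v x} {e₀}) := by
    intro x hx
    have hlift : ∀ γ ∈ (s x).1.support, ∃ Γ : C(unitInterval, E),
        p.comp Γ = γ ∧ Γ 0 = v x ∧ p (Γ 1) = p e₀ := fun γ hγ => by
      obtain ⟨Γ, hc, h0⟩ := cov.exists_path_lifts γ (v x) (hs x γ hγ).1
      exact ⟨Γ, DFunLike.coe_injective hc, h0, (congr_fun hc 1).trans (hs x γ hγ).2⟩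
    have hUx : ∀ e' ∈ U, p e' = p (v x) → e' = v x := fun e' he' h => hinj he' hx h
    have hsing : ∀ e' ∈ ({v x} : Set E), p e' = p (v x) → e' = v x := fun e' he' _ => he'
    rw [eq_sub_iff_add_eq', ← (s x).mass_add_mass_compl (liftableFromTo p {v x} {e₀})]
    refine ⟨FinProb.mass_congr _ fun γ hγ => ?_,
      congrArg _ (FinProb.mass_congr _ fun γ hγ => ?_)⟩ <;>
    obtain ⟨Γ, rfl, h0, h1⟩ := hlift γ hγ
    · rw [cov.liftableFromTo_singleton_iff hUx hx Γ h0,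
        cov.liftableFromTo_singleton_iff hsing rfl Γ h0]
      exact (hVW _ h1).1
    · rw [Set.mem_compl_iff, cov.liftableFromTo_singleton_iff hUx hx Γ h0,
        cov.liftableFromTo_singleton_iff hsing rfl Γ h0]
      exact (hVW _ h1).2
  have lsc : ∀ {W' : Set E}, IsOpen W' →
      LowerSemicontinuous fun x => (s x).mass (liftableFromTo p U W') := fun hW' =>
    (FinProb.lowerSemicontinuous_mass (cov.isOpen_liftableFromTo hU hW')).comp s.continuous
  refine tendsto_order.2 ⟨fun a ha => ?_, fun a ha => ?_⟩
  · replace ha := ha.trans_eq (key x₀ hxU).1.symm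
    filter_upwards [hN, lsc hV x₀ a ha] with x hx h
    rwa [← (key x hx).1]
  · have ha' : 1 - a < (s x₀).mass (liftableFromTo p U W) := by
      rw [(key x₀ hxU).2]
      linarith
    filter_upwards [hN, lsc hW x₀ _ ha'] with x hx h
    rw [(key x hx).2] at h
    linarith

theorem coincidenceSet_nonempty_iff {G : Type*} [Group G] {X : Type*} [MulAction G X]
    (f : X → ℝ) : (coincidenceSet G f).Nonempty ↔ ∃ x, ∀ g : G, f (g • x) = f x := by
  refine exists_congr fun x => ?_
  rw [coincidenceSet, Set.mem_ofPred_eq, Set.encard_eq_one]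
  constructor
  · rintro ⟨c, hc⟩ g
    have h : ∀ g : G, f (g • x) = c := fun g => by
      have : f (g • x) ∈ f '' MulAction.orbit G x := ⟨_, ⟨g, rfl⟩, rfl⟩
      rwa [hc] at this
    rw [h g, ← h 1, one_smul]
  · refine fun h => ⟨f x, Set.eq_singleton_iff_unique_mem.2
      ⟨⟨x, MulAction.mem_orbit_self x, rfl⟩, ?_⟩⟩
    rintro _ ⟨_, ⟨g, rfl⟩, rfl⟩
    exact h g

/-- A section by measures on fewer than `|G|` paths gives a function that is constant on no
orbit. -/
theorem exists_coincidenceSet_eq_empty_of_dcatLE {G : Type*} [Group G] [Finite G] {X : Type*}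
    [TopologicalSpace X] [MulAction G X] {EG BG : Type*} [TopologicalSpace EG]
    [TopologicalSpace BG] [MulAction G EG] {p : C(EG, BG)} (hp : IsQuotientCoveringMap p G)
    {b₀ : BG} {u : C(MulAction.orbitRel.Quotient G X, BG)} (hu : IsClassifyingMap G p u) {k : ℕ}
    (hk : k + 1 < Nat.card G) (h : DcatLE u b₀ k) :
    ∃ f : C(X, ℝ), ¬ (coincidenceSet G f).Nonempty := by
  classical
  obtain ⟨s, hs⟩ := h
  obtain ⟨v, hv, hvu⟩ := hu
  obtain ⟨e₀, rfl⟩ := hp.surjective b₀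
  have cov := hp.isCoveringMap
  have hcancel := hp.isCancelSMul
  have := hp.toContinuousConstSMul
  let s' : C(X, FinProb (k + 1) C(unitInterval, BG)) :=
    s.comp ⟨Quotient.mk _, continuous_quotient_mk'⟩
  have hs' : ∀ x, ∀ γ ∈ (s' x).1.support, γ 0 = p (v x) ∧ γ 1 = p e₀ := fun x γ hγ => by
    rw [hvu]
    exact hs _ γ hγ
  refine ⟨⟨_, continuous_mass_liftableFromTo cov e₀ v s' hs'⟩, ?_⟩
  rw [coincidenceSet_nonempty_iff]
  rintro ⟨x, hx⟩
  simp only [ContinuousMap.coe_mk] at hx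
  have hinv : ∀ g : G, s' (g • x) = s' x := fun g =>
    congrArg s (Quotient.sound ⟨g, rfl⟩)
  -- If Γ lifts γ from v(x), the lift from v(g'x) is g'Γ; by freeness it ends at e₀ for a single g'.
  have hlift : ∀ γ ∈ (s' x).1.support, ∃ g : G,
      ∀ g' : G, γ ∈ liftableFromTo p {v (g' • x)} {e₀} ↔ g' = g := fun γ hγ => by
    obtain ⟨Γ, hc, h0⟩ := cov.exists_path_lifts γ (v x) (hs' x γ hγ).1
    obtain ⟨g, hg⟩ := hp.apply_eq_iff_mem_orbit.1
      ((hs' x γ hγ).2.symm.trans (congr_fun hc 1).symm)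
    refine ⟨g, fun g' => ?_⟩
    let Γ' : C(unitInterval, EG) := ⟨fun t => g' • Γ t, Γ.continuous.const_smul g'⟩
    have hΓ' : p.comp Γ' = γ := by
      ext t
      exact (hp.map_smul g').trans (congr_fun hc t)
    rw [← hΓ', cov.liftableFromTo_singleton_iff (V := {v (g' • x)}) (e := v (g' • x)) (fun _ h _ => h) rfl Γ'
      (by simp [Γ', h0, hv])]
    change g' • Γ 1 = e₀ ↔ _
    rw [← hg]
    exact ⟨fun h => hcancel.right_cancel _ _ _ h, fun h => h ▸ rfl⟩
  choose! c hc using hlift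
  obtain ⟨γ, hγ⟩ := (s' x).support_nonempty
  -- Pigeonhole: at most k + 1 < |G| paths cannot select every group element.
  obtain ⟨g, hg⟩ : ∃ g, g ∉ (s' x).1.support.image c := by
    by_contra! h
    have := Fintype.ofFinite G
    have h₁ : Finset.univ ⊆ (s' x).1.support.image c := fun g _ => h g
    have h₂ := (Finset.card_le_card h₁).trans
      (Finset.card_image_le.trans (s' x).2.2.2)
    rw [Finset.card_univ, ← Nat.card_eq_fintype_card] at h₂
    omega
  have h₀ : (s' (g • x)).mass (liftableFromTo p {v (g • x)} {e₀}) = 0 := by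
    rw [hinv]
    refine FinProb.mass_eq_zero _ fun z hz hmem => hg ?_
    rw [(hc z hz g).1 hmem]
    exact Finset.mem_image_of_mem c hz
  have h₁ : 0 < (s' (c γ • x)).mass (liftableFromTo p {v (c γ • x)} {e₀}) := by
    rw [hinv]
    exact FinProb.mass_pos _ hγ ((hc γ hγ _).2 rfl)
  rw [hx, ← hx g, h₀] at h₁
  exact lt_irrefl _ h₁

/-! ### From a function to a section -/

/-- The points of a contractible space are joined to a given point by continuously chosen
paths. -/
theorem ContractibleSpace.exists_continuous_paths (E : Type*) [TopologicalSpace E]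
    [ContractibleSpace E] (e₀ : E) :
    ∃ P : C(E, C(unitInterval, E)), ∀ e, P e 0 = e ∧ P e 1 = e₀ := by
  obtain ⟨e₁, ⟨H⟩⟩ := id_nullhomotopic E
  obtain ⟨c⟩ := PathConnectedSpace.joined e₁ e₀
  -- The contraction ends at some e₁; a fixed path then moves e₁ to e₀.
  let K : (ContinuousMap.const E e₁).Homotopy (ContinuousMap.const E e₀) :=
    ⟨⟨fun q => c q.1, by fun_prop⟩, fun _ => c.source, fun _ => c.target⟩
  let F := H.trans K
  refine ⟨(F.toContinuousMap.comp ⟨Prod.swap, continuous_swap⟩).curry, fun e => ⟨?_, ?_⟩⟩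
  · exact F.apply_zero e
  · exact F.apply_one e

theorem sum_comp_equiv_ne {ι κ M : Type*} [Fintype ι] [Fintype κ] [AddCommMonoid M] {i₀ : ι}
    (e : κ ≃ {i // i ≠ i₀}) {F : ι → M} (h : F i₀ = 0) : ∑ k, F (e k) = ∑ i, F i := by
  classical
  rw [e.sum_comp fun i => F i.1, ← Finset.sum_subtype (Finset.univ.erase i₀) (by simp),
    Finset.sum_erase _ h]

/-- A function that is constant on no orbit gives a section by measures on fewer than `|G|`
paths. -/
theorem dcatLE_of_coincidenceSet_eq_empty {G : Type*} [Group G] [Finite G] {X : Type*}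
    [TopologicalSpace X] [MulAction G X] [ContinuousConstSMul G X] {EG BG : Type*}
    [TopologicalSpace EG] [TopologicalSpace BG] [MulAction G EG] {p : C(EG, BG)}
    (hp : IsUniversalGCovering G p) (b₀ : BG) {u : C(MulAction.orbitRel.Quotient G X, BG)}
    (hu : IsClassifyingMap G p u) {k : ℕ} (hk : Nat.card G = k + 2) (f : C(X, ℝ))
    (hf : ¬ (coincidenceSet G f).Nonempty) : DcatLE u b₀ k := by
  classical
  have := Fintype.ofFinite G
  have := hp.contractible
  obtain ⟨v, hv, hvu⟩ := hu
  obtain ⟨e₀, rfl⟩ := hp.isQuotientCoveringMap.surjective b₀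
  obtain ⟨P, hP⟩ := ContractibleSpace.exists_continuous_paths EG e₀
  rw [coincidenceSet_nonempty_iff] at hf
  push Not at hf
  let π : C(X, C(unitInterval, BG)) :=
    ⟨fun x => p.comp (P (v x)), (p.continuous_postcomp).comp (P.continuous.comp v.continuous)⟩
  let low : X → ℝ := fun x => Finset.univ.inf' Finset.univ_nonempty fun g : G => f (g • x)
  have hlow : Continuous low :=
    Continuous.finset_inf'_apply _ fun g _ => f.continuous.comp (continuous_const_smul g)
  have hlow_smul : ∀ (g : G) x, low (g • x) = low x := fun g x => by
    refine le_antisymm (Finset.le_inf' _ _ fun h _ => ?_) (Finset.le_inf' _ _ fun h _ => ?_)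
    · refine (Finset.inf'_le _ (Finset.mem_univ (h * g⁻¹))).trans_eq ?_
      rw [smul_smul, inv_mul_cancel_right]
    · refine (Finset.inf'_le _ (Finset.mem_univ (h * g))).trans_eq ?_
      rw [mul_smul]
  let d : X → ℝ := fun x => f x - low x
  have hd : Continuous d := f.continuous.sub hlow
  have hd0 : ∀ x, 0 ≤ d x := fun x => sub_nonneg.2 <|
    (Finset.inf'_le _ (Finset.mem_univ (1 : G))).trans_eq (by rw [one_smul])
  have hdz : ∀ x, ∃ g : G, d (g • x) = 0 := fun x => by
    obtain ⟨g, -, hg⟩ := Finset.exists_mem_eq_inf' (Finset.univ_nonempty (α := G))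
      fun g : G => f (g • x)
    exact ⟨g, by rw [sub_eq_zero, hlow_smul]; exact hg.symm⟩
  let S : X → ℝ := fun x => ∑ g : G, d (g • x)
  have hS : Continuous S := continuous_finsetSum _ fun g _ => hd.comp (continuous_const_smul g)
  have hS_smul : ∀ (g : G) x, S (g • x) = S x := fun g x => by
    refine Fintype.sum_equiv (Equiv.mulRight g) _ _ fun h => ?_
    rw [smul_smul, Equiv.coe_mulRight]
  -- S(x) = 0 would make f equal to its minimum on the whole orbit of x.
  have hSpos : ∀ x, 0 < S x := fun x => by
    refine lt_of_le_of_ne (Finset.sum_nonneg fun g _ => hd0 _) fun h => ?_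
    have h0 := (Finset.sum_eq_zero_iff_of_nonneg fun g _ => hd0 (g • x)).1 h.symm
    have h1 : ∀ g : G, f (g • x) = low x := fun g => by
      rw [← hlow_smul g]
      exact sub_eq_zero.1 (h0 g (Finset.mem_univ g))
    obtain ⟨g, hg⟩ := hf x
    apply hg
    rw [h1, ← h1 1, one_smul]
  let w : X → ℝ := fun x => d x / S x
  have hw : Continuous w := hd.div hS fun x => (hSpos x).ne'
  have hw0 : ∀ x, 0 ≤ w x := fun x => div_nonneg (hd0 x) (hSpos x).le
  have hwsum : ∀ x, ∑ g : G, w (g • x) = 1 := fun x => by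
    simp only [w, hS_smul]
    rw [← Finset.sum_div]
    exact div_self (hSpos x).ne'
  have hwz : ∀ x, ∃ g : G, w (g • x) = 0 := fun x =>
    (hdz x).imp fun g hg => by simp only [w, hg, zero_div]
  let μ : X → (C(unitInterval, BG) →₀ ℝ) := fun x =>
    ∑ g : G, Finsupp.single (π (g • x)) (w (g • x))
  have hcard : ∀ g₀ : G, Fintype.card {g : G // g ≠ g₀} = k + 1 := fun g₀ => by
    rw [Fintype.card_subtype_compl, Fintype.card_subtype_eq, ← Nat.card_eq_fintype_card, hk]
    rfl
  let ε : ∀ g₀ : G, {g : G // g ≠ g₀} ≃ Fin (k + 1) := fun g₀ =>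
    Fintype.equivFinOfCardEq (hcard g₀)
  -- On C(g₀) the term of g₀ drops out, so the other k + 1 terms lift s continuously to simplex
  -- times paths. These finitely many closed sets cover X, so s is continuous.
  let C : G → Set X := fun g₀ => {x | w (g₀ • x) = 0}
  let q : ∀ g₀ : G, C g₀ → stdSimplex ℝ (Fin (k + 1)) × (Fin (k + 1) → C(unitInterval, BG)) :=
    fun g₀ x => ⟨⟨fun i => w (((ε g₀).symm i).1 • x.1), fun i => hw0 _,
      (sum_comp_equiv_ne (ε g₀).symm (F := fun g => w (g • x.1)) x.2).trans (hwsum x.1)⟩,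
      fun i => π (((ε g₀).symm i).1 • x.1)⟩
  have hq : ∀ g₀, Continuous (q g₀) := fun g₀ => by
    have h : ∀ i, Continuous fun x : C g₀ => ((ε g₀).symm i).1 • x.1 := fun i =>
      (continuous_const_smul _).comp continuous_subtype_val
    exact (Continuous.subtype_mk (continuous_pi fun i => hw.comp (h i)) _).prodMk
      (continuous_pi fun i => π.continuous.comp (h i))
  have hqμ : ∀ g₀ (x : C g₀), (FinProb.mk' (k + 1) _ (q g₀ x)).1 = μ x.1 := fun g₀ x =>
    sum_comp_equiv_ne (ε g₀).symm (F := fun g => Finsupp.single (π (g • x.1)) (w (g • x.1)))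
      (by rw [show w (g₀ • x.1) = 0 from x.2, Finsupp.single_zero])
  let s : X → FinProb (k + 1) C(unitInterval, BG) := fun x => ⟨μ x, by
    obtain ⟨g₀, hg₀⟩ := hwz x
    rw [← hqμ g₀ ⟨x, hg₀⟩]
    exact (FinProb.mk' (k + 1) _ _).2⟩
  have hs : Continuous s := by
    refine (locallyFinite_of_finite C).continuous
      (Set.eq_univ_of_forall fun x => Set.mem_iUnion.2 (hwz x))
      (fun g => isClosed_eq (hw.comp (continuous_const_smul g)) continuous_const) fun g => ?_
    rw [continuousOn_iff_continuous_domRestrict]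
    have : (C g).domRestrict s = FinProb.mk' (k + 1) _ ∘ q g :=
      funext fun x => Subtype.ext (hqμ g x).symm
    rw [this]
    exact continuous_coinduced_rng.comp (hq g)
  have hs_smul : ∀ (g : G) x, s (g • x) = s x := fun g x => Subtype.ext <| by
    refine Fintype.sum_equiv (Equiv.mulRight g) _ _ fun h => ?_
    rw [smul_smul, Equiv.coe_mulRight]
  have hrel : ∀ a b, MulAction.orbitRel G X a b → s a = s b := by
    rintro _ x ⟨g, rfl⟩
    exact hs_smul g x
  refine ⟨⟨Quotient.lift s hrel, hs.quotient_lift hrel⟩, ?_⟩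
  rintro ⟨x⟩ γ hγ
  replace hγ : γ ∈ (μ x).support := hγ
  obtain ⟨g, -, hg⟩ := Finset.mem_biUnion.1 (Finsupp.support_finsetSum hγ)
  obtain rfl := Finset.mem_singleton.1 (Finsupp.support_single_subset hg)
  refine ⟨?_, congrArg p (hP _).2⟩
  change p (P (v (g • x)) 0) = u (Quotient.mk _ x)
  rw [(hP _).1, hv, hp.isQuotientCoveringMap.map_smul, hvu]

theorem mainTheorem12 {G : Type*} [Group G] [Finite G] (n : ℕ) (hG : Nat.card G = n + 1)
    {X : Type*} [TopologicalSpace X] [T2Space X] [Nonempty X]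
    [Topology.CWComplex (Set.univ : Set X)] [Topology.CWComplex.Finite (Set.univ : Set X)]
    [MulAction G X] [ContinuousConstSMul G X] [IsCancelSMul G X]
    {EG BG : Type*} [TopologicalSpace EG] [TopologicalSpace BG] [MulAction G EG]
    (p : C(EG, BG)) (hp : IsUniversalGCovering G p) (b₀ : BG)
    (u : C(MulAction.orbitRel.Quotient G X, BG)) (hu : IsClassifyingMap G p u) :
    (n : ℕ∞) ≤ dcat u b₀ ↔ ∀ f : C(X, ℝ), (coincidenceSet G f).Nonempty := by
  have hle : (n : ℕ∞) ≤ dcat u b₀ ↔ ∀ k, DcatLE u b₀ k → n ≤ k := by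
    rw [dcat, le_sInf_iff]
    refine ⟨fun h k hk => ENat.natCast_le_natCast.1 (h _ ⟨k, rfl, hk⟩), ?_⟩
    rintro h _ ⟨k, rfl, hk⟩
    exact ENat.natCast_le_natCast.2 (h k hk)
  rw [hle]
  constructor
  · intro h f
    by_contra hf
    -- For n = 0 the group is trivial and every orbit is a point; otherwise n = k + 1, and a section
    -- with `DcatLE u b₀ k` contradicts the bound.
    obtain _ | k := n
    · have : Subsingleton G := (Nat.card_eq_one_iff_unique.1 hG).1
      refine hf ((coincidenceSet_nonempty_iff _).2 ⟨Classical.arbitrary X, fun g => ?_⟩)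
      rw [Subsingleton.elim g 1, one_smul]
    · exact absurd (h k (dcatLE_of_coincidenceSet_eq_empty hp b₀ hu hG f hf)) (by omega)
  · intro h k hk
    by_contra hlt
    obtain ⟨f, hf⟩ := exists_coincidenceSet_eq_empty_of_dcatLE hp.isQuotientCoveringMap hu
      (by omega) hk
    exact hf (h f)
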